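/- There is a numerical constant $C_1>0$ such that the following holds. Let $(X_1,Y_1),\dots,(X_N,Y_N)$, $N\ge 2$, be i.i.d. random pairs with common law $P$ on a product of measurable spaces $\mathcal X\times\mathcal Y$. Let $V:\mathcal X\times\mathcal Y\to[-\infty,\infty]$ be a fixed measurable conformity score, and for a threshold $\eta\in[-\infty,\infty]$ let $C_\eta(x)=\{y\in\mathcal Y: V(x,y)\ge\eta\}$ be the corresponding conformal prediction set. Let $\mathcal H$ be a family of measurable binary classifiers $h:\mathcal X\to\{0,1\}$ with VC dimension $VC(\mathcal H)\le R$ for an integer $R\ge 1$. Assume that $\mathcal H$ satisfies the usual measurability condition: for all $m$ and all $s\in\{0,1\}^m$, the set $\{(x_1,\dots,x_m)\in\mathcal X^m:\exists h\in\mathcal H,\ h(x_i)=s_i\ \forall i\}$ is measurable with respect to the completion of the $m$-fold product of the law of $X_1$ (this is automatic if $\mathcal H$ is countable). For $h\in\mathcal H$ let $\hat{\mathcal G}_h=\{i\le N: h(X_i)=1\}$ be the group selected by $h$ in the data, and let $\delta_h=|\hat{\mathcal G}_h|/N$ be its proportion. Let $$\mathbb P_n[Y\in C_\eta(X)\mid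 X\in\hat{\mathcal G}_h]=\frac{|\{i\in\hat{\mathcal G}_h: Y_i\in C_\eta(X_i)\}|}{|\hat{\mathcal G}_h|}$$ be the empirical conditional coverage, and let $\mathbb P[Y\in C_\eta(X)\mid X\in\hat{\mathcal G}_h]=P(Y\in C_\eta(X)\mid h(X)=1)$ be the oracle conditional coverage (read as $0$ if $P(h(X)=1)=0$). Then, for every $\tau>0$, with probability at least $1-e^{-\tau}$, simultaneously for all $h\in\mathcal H$ with $\delta_h>0$ and all thresholds $\eta$, $$\bigl|\mathbb P_n[Y\in C_\eta(X)\mid X\in\hat{\mathcal G}_h]-\mathbb P[Y\in C_\eta(X)\mid X\in\hat{\mathcal G}_h]\bigr|\le C_1\sqrt{\frac{R\log N+\tau}{\delta_h N}}.$$ In particular the threshold may be computed from the data, and $C_\eta$ may be replaced by any fixed measurable prediction set. -/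

import Mathlib

open MeasureTheory ProbabilityTheory

namespace GroupCoverage

/-- A family `H` of binary classifiers shatters the finite set `s` if every subset `t` of `s` is
cut out of `s` by some member of `H`. -/
def Shatters {𝒳 : Type*} (H : Set (𝒳 → Bool)) (s : Finset 𝒳) : Prop :=
  ∀ t : Finset 𝒳, t ⊆ s → ∃ h ∈ H, ∀ x ∈ s, h x = true ↔ x ∈ t

/-- The Vapnik–Chervonenkis dimension of a family of binary classifiers: the supremum of the
cardinalities of the finite sets it shatters, possibly infinite. -/
noncomputable def vcDim {𝒳 : Type*} (H : Set (𝒳 → Bool)) : ℕ∞ :=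
  ⨆ s : Finset 𝒳, ⨆ _ : Shatters H s, (s.card : ℕ∞)

/-- Measurability of an uncountable family of classifiers relative to a law `Q` of the features:
for each labelling `s` of `m` points, the set of those `m`-tuples of points on which some member of
`H` produces the labelling `s` is measurable with respect to (the completion of) `Q ^ m`.
Every countable family of measurable classifiers has this property. -/
def TraceMeasurable {𝒳 : Type*} [MeasurableSpace 𝒳] (H : Set (𝒳 → Bool)) (Q : Measure 𝒳) : Prop :=
  ∀ (m : ℕ) (s : Fin m → Bool),
    NullMeasurableSet {x : Fin m → 𝒳 | ∃ h ∈ H, ∀ i, h (x i) = s i} (Measure.pi fun _ => Q)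

/-- The conformal prediction set `{y | V(x, y) ≥ η}` given by a conformity score and a threshold. -/
def predictionSet {𝒳 𝒴 : Type*} (V : 𝒳 → 𝒴 → EReal) (η : EReal) (x : 𝒳) : Set 𝒴 :=
  {y | η ≤ V x y}

/-- The group selected by `h` in the data set `d` (as a set of indices): the observations whose
features are classified as members. -/
def selectedGroup {𝒳 𝒴 : Type*} {N : ℕ} (h : 𝒳 → Bool) (d : Fin N → 𝒳 × 𝒴) : Finset (Fin N) :=
  {i | h (d i).1 = true}

/-- The proportion of the selected group in the whole data set. -/
noncomputable def proportion {𝒳 𝒴 : Type*} {N : ℕ} (h : 𝒳 → Bool) (d : Fin N → 𝒳 × 𝒴) : ℝ :=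
  ((selectedGroup h d).card : ℝ) / N

open Classical in
/-- Empirical conditional coverage: the fraction of the observations `(x, y)` of the selected group
that satisfy `y ∈ C x`. -/
noncomputable def empiricalCoverage {𝒳 𝒴 : Type*} {N : ℕ} (C : 𝒳 → Set 𝒴) (h : 𝒳 → Bool)
    (d : Fin N → 𝒳 × 𝒴) : ℝ :=
  (((selectedGroup h d).filter fun i => (d i).2 ∈ C (d i).1).card : ℝ) / (selectedGroup h d).card

/-- Oracle conditional coverage: the probability, under the law `P` of `(X, Y)`, of `Y ∈ C X`
conditionally on `X` belonging to the group `{x | h x = true}`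
(it is `0` when the group has probability zero). -/
noncomputable def oracleCoverage {𝒳 𝒴 : Type*} [MeasurableSpace 𝒳] [MeasurableSpace 𝒴]
    (P : Measure (𝒳 × 𝒴)) (C : 𝒳 → Set 𝒴) (h : 𝒳 → Bool) : ℝ :=
  (ProbabilityTheory.cond P {z | h z.1 = true}).real {z | z.2 ∈ C z.1}

end GroupCoverage

namespace GroupCoverage

open Finset

/-! The proof is a symmetrization carried out at the scale of the group rather than of the whole
sample. Put T = R log N + τ. For a group and a threshold, let u and v count the selected points with
score at least η in the data and in an independent ghost sample, and let s be their common
expectation. Given the double sample, exchanging the two copies of randomly chosen indices preserves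
the law and u + v, while u - v becomes a sum of random signs with variance at most u + v. Hoeffding
gives |u - v| ≤ 4√(T(u + v)) outside a proportion 2e^{-8T} of the swaps (`card_imbalanced_le`).
Normalizing by u + v instead of N is what produces δ_h N in the final rate.

On 2N points only finitely many sets occur: at most (2N+1)^R traces of the classifiers by
Sauer–Shelah, times 2N cutoffs, because a threshold may be raised to the lowest score it retains.
The resulting union bound is `measure_imbalancedSamples_le`.

For each fixed group and threshold, Chebyshev places v near s with probability at least 1/2; this
suffices to replace the ghost count by its expectation (`exists_measurableSet_ghost`,
`abs_card_scoreTrace_sub_le`). In terms of square roots, |√u - √v| and |√v - √s| are both at most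
4√T, whence |u - s| ≤ 16√(Tu) + 64T. The threshold ⊥ yields the group size itself, so numerator and
denominator of the coverage obey the same estimate, and `abs_div_sub_div_le` concludes. -/

/-- The permutation of two copies of `ι` which exchanges the copies of those `i` with `σ i`. -/
def swapPerm {ι : Type*} (σ : ι → Bool) : Equiv.Perm (ι ⊕ ι) :=
  Function.Involutive.toPerm
    (Sum.elim (fun i => if σ i then Sum.inr i else Sum.inl i)
      (fun i => if σ i then Sum.inl i else Sum.inr i))
    (by rintro (i | i) <;> by_cases h : σ i <;> simp [h])

theorem swapPerm_inl {ι : Type*} (σ : ι → Bool) (i : ι) :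
    swapPerm σ (Sum.inl i) = if σ i then Sum.inr i else Sum.inl i := rfl

theorem swapPerm_inr {ι : Type*} (σ : ι → Bool) (i : ι) :
    swapPerm σ (Sum.inr i) = if σ i then Sum.inl i else Sum.inr i := rfl

/-! ### Concentration under random swaps -/

section Rademacher

variable {ι : Type*} [Fintype ι] [DecidableEq ι]

/-- The sign attached to a boolean: `true` flips. -/
def flipSign (b : Bool) : ℝ := if b then -1 else 1

/-- The sum over sign patterns factors over coordinates, and each factor is 2 cosh(l c_i) ≤ 2 exp(l²
c_i² / 2). -/
theorem sum_exp_flipSign_le (c : ι → ℝ) (l : ℝ) :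
    ∑ σ : ι → Bool, Real.exp (l * ∑ i, flipSign (σ i) * c i) ≤
      2 ^ Fintype.card ι * Real.exp (l ^ 2 * (∑ i, c i ^ 2) / 2) := by
  have h1 : ∑ σ : ι → Bool, Real.exp (l * ∑ i, flipSign (σ i) * c i)
      = ∏ i, ∑ b : Bool, Real.exp (l * (flipSign b * c i)) := by
    rw [Fintype.prod_sum]
    refine sum_congr rfl fun σ _ => ?_
    rw [mul_sum, Real.exp_sum]
  have h2 : ∀ i, ∑ b : Bool, Real.exp (l * (flipSign b * c i))
      ≤ 2 * Real.exp (l ^ 2 * c i ^ 2 / 2) := by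
    intro i
    have h := Real.cosh_le_exp_half_sq (l * c i)
    rw [Real.cosh_eq, mul_pow] at h
    simp only [Fintype.sum_bool, flipSign, if_true, Bool.false_eq_true, if_false, one_mul,
      neg_mul, mul_neg]
    linarith
  rw [h1]
  calc ∏ i, ∑ b : Bool, Real.exp (l * (flipSign b * c i))
      ≤ ∏ i, (2 * Real.exp (l ^ 2 * c i ^ 2 / 2)) :=
        prod_le_prod (fun i _ => sum_nonneg fun _ _ => (Real.exp_pos _).le) fun i _ => h2 i
    _ = 2 ^ Fintype.card ι * Real.exp (l ^ 2 * (∑ i, c i ^ 2) / 2) := by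
        rw [prod_mul_distrib, prod_const, card_univ, ← Real.exp_sum, mul_sum, sum_div]

theorem card_flipSign_one_sided_le (c : ι → ℝ) {v r : ℝ} (hv : 0 < v) (hc : ∑ i, c i ^ 2 ≤ v)
    (hr : 0 ≤ r) :
    ((univ.filter fun σ : ι → Bool => r < ∑ i, flipSign (σ i) * c i).card : ℝ) ≤
      2 ^ Fintype.card ι * Real.exp (-(r ^ 2 / (2 * v))) := by
  -- This value minimizes l² v / 2 - l r in the Chernoff bound.
  set l := r / v
  have hl : 0 ≤ l := by positivity
  have h1 : ((univ.filter fun σ : ι → Bool => r < ∑ i, flipSign (σ i) * c i).card : ℝ)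
      * Real.exp (l * r) ≤ ∑ σ : ι → Bool, Real.exp (l * ∑ i, flipSign (σ i) * c i) := by
    rw [← nsmul_eq_mul, ← sum_const]
    refine (sum_le_sum (fun σ hσ => ?_)).trans
      (sum_le_univ_sum_of_nonneg (s := univ.filter fun σ : ι → Bool =>
        r < ∑ i, flipSign (σ i) * c i) fun σ => (Real.exp_pos _).le)
    rw [mem_filter] at hσ
    exact Real.exp_le_exp.2 (mul_le_mul_of_nonneg_left hσ.2.le hl)
  have h2 := h1.trans (sum_exp_flipSign_le c l)
  rw [← le_div_iff₀ (Real.exp_pos _), mul_div_assoc, ← Real.exp_sub] at h2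
  refine h2.trans (mul_le_mul_of_nonneg_left (Real.exp_le_exp.2 ?_) (by positivity))
  have h3 : l ^ 2 * ∑ i, c i ^ 2 ≤ l ^ 2 * v := mul_le_mul_of_nonneg_left hc (sq_nonneg _)
  have h4 : l ^ 2 * v / 2 - l * r = -(r ^ 2 / (2 * v)) := by
    simp only [l]; field_simp; ring
  linarith

/-- Hoeffding's inequality for weighted sums of independent random signs, in counting form. -/
theorem card_flipSign_le (c : ι → ℝ) {v r : ℝ} (hv : 0 < v) (hc : ∑ i, c i ^ 2 ≤ v)
    (hr : 0 ≤ r) :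
    ((univ.filter fun σ : ι → Bool => r < |∑ i, flipSign (σ i) * c i|).card : ℝ) ≤
      2 ^ Fintype.card ι * (2 * Real.exp (-(r ^ 2 / (2 * v)))) := by
  have h1 := card_flipSign_one_sided_le c hv hc hr
  have h2 := card_flipSign_one_sided_le (fun i => -c i) hv (by simpa using hc) hr
  have h3 : (univ.filter fun σ : ι → Bool => r < |∑ i, flipSign (σ i) * c i|) ⊆
      (univ.filter fun σ : ι → Bool => r < ∑ i, flipSign (σ i) * c i) ∪
      (univ.filter fun σ : ι → Bool => r < ∑ i, flipSign (σ i) * (-c i)) := by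
    intro σ
    simp only [mem_filter, mem_univ, true_and, mem_union, lt_abs, mul_neg, sum_neg_distrib]
    exact id
  have h4 : ((univ.filter fun σ : ι → Bool => r < |∑ i, flipSign (σ i) * c i|).card : ℝ) ≤ _ :=
    Nat.cast_le.2 ((card_le_card h3).trans (card_union_le _ _))
  push_cast at h4
  linarith

/-- The number of elements of `t` in the first copy minus the number in the second. -/
def imbalance (t : Finset (ι ⊕ ι)) : ℝ :=
  ∑ i, ((if Sum.inl i ∈ t then 1 else 0) - (if Sum.inr i ∈ t then 1 else 0))

/-- A set is imbalanced at level `T` if its imbalance exceeds `4 √(T |t|)`. -/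
def Imbalanced (T : ℝ) (t : Finset (ι ⊕ ι)) : Prop :=
  4 * Real.sqrt (T * t.card) < |imbalance t|

theorem card_sum_eq (t : Finset (ι ⊕ ι)) :
    (t.card : ℝ) = ∑ i, ((if Sum.inl i ∈ t then 1 else 0) + (if Sum.inr i ∈ t then 1 else 0)) := by
  rw [sum_add_distrib, ← Fintype.sum_sum_type (fun j => if j ∈ t then (1 : ℝ) else 0)]
  simp

theorem not_imbalanced_empty (T : ℝ) : ¬ Imbalanced T (∅ : Finset (ι ⊕ ι)) := by
  simp [Imbalanced, imbalance]

theorem imbalance_swapPerm (σ : ι → Bool) (t : Finset (ι ⊕ ι)) :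
    imbalance (univ.filter fun j => swapPerm σ j ∈ t) = ∑ i, flipSign (σ i) *
      ((if Sum.inl i ∈ t then 1 else 0) - (if Sum.inr i ∈ t then 1 else 0)) := by
  refine sum_congr rfl fun i _ => ?_
  simp only [mem_filter, mem_univ, true_and, swapPerm_inl, swapPerm_inr]
  by_cases h : σ i <;> simp [h, flipSign]

theorem card_swapPerm (σ : ι → Bool) (t : Finset (ι ⊕ ι)) :
    (univ.filter fun j => swapPerm σ j ∈ t).card = t.card := by
  refine card_bij (fun j _ => swapPerm σ j) (by simp) (fun _ _ _ _ h => (swapPerm σ).injective h)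
    fun j hj => ⟨(swapPerm σ).symm j, by simpa using hj, by simp⟩

-- Each coefficient is -1, 0 or 1, so the sum of squares is at most |t|. Since the imbalance level
-- scales as √|t|, the Hoeffding exponent 16 T |t| / (2 |t|) = 8T does not depend on t.
open Classical in
theorem card_imbalanced_le {T : ℝ} (hT : 0 ≤ T) (t : Finset (ι ⊕ ι)) :
    ((univ.filter fun σ : ι → Bool =>
      Imbalanced T (univ.filter fun j => swapPerm σ j ∈ t)).card : ℝ) ≤
      2 ^ Fintype.card ι * (2 * Real.exp (-(8 * T))) := by
  rcases t.eq_empty_or_nonempty with rfl | ht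
  · simp only [notMem_empty, filter_false, not_imbalanced_empty, card_empty, Nat.cast_zero]
    positivity
  have hv : (0 : ℝ) < t.card := by exact_mod_cast ht.card_pos
  have h := card_flipSign_le
    (fun i => (if Sum.inl i ∈ t then (1 : ℝ) else 0) - (if Sum.inr i ∈ t then 1 else 0))
    (r := 4 * Real.sqrt (T * t.card)) hv (by
      rw [card_sum_eq]
      refine sum_le_sum fun i _ => ?_
      split_ifs <;> norm_num) (by positivity)
  have h8 : (4 * Real.sqrt (T * t.card)) ^ 2 / (2 * t.card) = 8 * T := by
    rw [mul_pow, Real.sq_sqrt (by positivity)]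
    field_simp
    ring
  rw [h8] at h
  simpa only [Imbalanced, imbalance_swapPerm, card_swapPerm] using h

end Rademacher

/-! ### Sauer–Shelah bound for traces -/

section Sauer

theorem sum_choose_le_pow (n : ℕ) (R : ℕ) : ∑ k ∈ Iic R, n.choose k ≤ (n + 1) ^ R := by
  rw [← Nat.range_succ_eq_Iic]
  induction R with
  | zero => simp
  | succ R ih =>
    rw [sum_range_succ]
    have h1 : n.choose (R + 1) ≤ n ^ (R + 1) := Nat.choose_le_pow n (R + 1)
    have h2 : n ^ R ≤ (n + 1) ^ R := Nat.pow_le_pow_left (Nat.le_succ n) R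
    have h3 : n ^ R * n ≤ (n + 1) ^ R * n := Nat.mul_le_mul_right n h2
    rw [pow_succ] at h1 ⊢
    linarith

variable {𝒳 κ : Type*} [Fintype κ]

open Classical in
/-- The traces of the members of `H` on a finite family of points. -/
noncomputable def traces (H : Set (𝒳 → Bool)) (x : κ → 𝒳) : Finset (Finset κ) :=
  {t | ∃ h ∈ H, ∀ i, h (x i) = true ↔ i ∈ t}

theorem mem_traces {H : Set (𝒳 → Bool)} {x : κ → 𝒳} {t : Finset κ} :
    t ∈ traces H x ↔ ∃ h ∈ H, ∀ i, h (x i) = true ↔ i ∈ t := by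
  simp [traces]

/-- Equal points get equal labels, so indices in a shattered set carry distinct points; the image of
the set is then shattered by `H` and has the same cardinality. -/
theorem card_le_of_shatters_traces [DecidableEq κ] {H : Set (𝒳 → Bool)} {R : ℕ} (hR : vcDim H ≤ R) {x : κ → 𝒳}
    {s : Finset κ} (hs : (traces H x).Shatters s) : s.card ≤ R := by
  classical
  have hinj : Set.InjOn x s := by
    intro i hi j hj hij
    by_contra hne
    obtain ⟨u, hu, hsu⟩ := hs (t := {i}) (by simpa using hi)
    obtain ⟨h, -, hh⟩ := mem_traces.1 hu
    have hiu : i ∈ u := (mem_inter.1 (hsu ▸ mem_singleton_self i)).2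
    have hju : j ∈ u := (hh j).1 (hij ▸ (hh i).2 hiu)
    have hj' : j ∈ s ∩ u := mem_inter.2 ⟨hj, hju⟩
    rw [hsu, mem_singleton] at hj'
    exact hne hj'.symm
  have hsh : GroupCoverage.Shatters H (s.image x) := by
    intro t ht
    obtain ⟨u, hu, hsu⟩ := hs (t := s.filter fun i => x i ∈ t) (filter_subset _ _)
    obtain ⟨h, hH, hh⟩ := mem_traces.1 hu
    refine ⟨h, hH, fun y hy => ?_⟩
    obtain ⟨i, hi, rfl⟩ := mem_image.1 hy
    rw [hh i]
    have := congrArg (i ∈ ·) hsu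
    simpa [hi] using this
  have h1 : ((s.image x).card : ℕ∞) ≤ vcDim H :=
    le_iSup₂_of_le (f := fun (s : Finset 𝒳) (_ : GroupCoverage.Shatters H s) => (s.card : ℕ∞))
      (s.image x) hsh le_rfl
  rw [card_image_of_injOn hinj] at h1
  exact_mod_cast h1.trans hR

theorem card_traces_le {H : Set (𝒳 → Bool)} {R : ℕ} (hR : vcDim H ≤ R) (x : κ → 𝒳) :
    (traces H x).card ≤ (Fintype.card κ + 1) ^ R := by
  classical
  have hvc : (traces H x).vcDim ≤ R :=
    Finset.sup_le fun s hs => card_le_of_shatters_traces hR (mem_shatterer.1 hs)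
  calc (traces H x).card ≤ (traces H x).shatterer.card := card_le_card_shatterer _
    _ ≤ ∑ k ∈ Iic (traces H x).vcDim, (Fintype.card κ).choose k := card_shatterer_le_sum_vcDim
    _ ≤ (Fintype.card κ + 1) ^ (traces H x).vcDim := sum_choose_le_pow _ _
    _ ≤ (Fintype.card κ + 1) ^ R := Nat.pow_le_pow_right (Nat.succ_pos _) hvc

end Sauer

/-! ### Reduction to finitely many thresholds -/

section Trace

variable {𝒳 𝒴 κ : Type*} [Fintype κ]

open Classical in
/-- The indices of those points of `z` which lie in the group of `h` and have score at least `η`. -/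
noncomputable def scoreTrace (V : 𝒳 → 𝒴 → EReal) (h : 𝒳 → Bool) (η : EReal) (z : κ → 𝒳 × 𝒴) :
    Finset κ :=
  {j | h (z j).1 = true ∧ η ≤ V (z j).1 (z j).2}

theorem mem_scoreTrace {V : 𝒳 → 𝒴 → EReal} {h : 𝒳 → Bool} {η : EReal} {z : κ → 𝒳 × 𝒴} {j : κ} :
    j ∈ scoreTrace V h η z ↔ h (z j).1 = true ∧ η ≤ V (z j).1 (z j).2 := by
  simp [scoreTrace]

open Classical in
/-- The members of `A` whose score is at least that of `k`. -/
noncomputable def upperPart (V : 𝒳 → 𝒴 → EReal) (z : κ → 𝒳 × 𝒴) (A : Finset κ) (k : κ) :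
    Finset κ :=
  {j | j ∈ A ∧ V (z k).1 (z k).2 ≤ V (z j).1 (z j).2}

theorem mem_upperPart {V : 𝒳 → 𝒴 → EReal} {z : κ → 𝒳 × 𝒴} {A : Finset κ} {k j : κ} :
    j ∈ upperPart V z A k ↔ j ∈ A ∧ V (z k).1 (z k).2 ≤ V (z j).1 (z j).2 := by
  simp [upperPart]

/-- Raising η to the lowest score among the retained points changes nothing on the sample, so
cutoffs at sample scores suffice. -/
theorem exists_upperPart_eq_scoreTrace {V : 𝒳 → 𝒴 → EReal} {H : Set (𝒳 → Bool)} {h : 𝒳 → Bool}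
    (hH : h ∈ H) {η : EReal} {z : κ → 𝒳 × 𝒴} (hne : (scoreTrace V h η z).Nonempty) :
    ∃ A ∈ traces H (fun j => (z j).1), ∃ k, upperPart V z A k = scoreTrace V h η z := by
  classical
  obtain ⟨k, hk, hmin⟩ := exists_min_image _ (fun j => V (z j).1 (z j).2) hne
  refine ⟨univ.filter fun j => h (z j).1 = true, mem_traces.2 ⟨h, hH, by simp⟩, k, ?_⟩
  ext j
  rw [mem_upperPart, mem_scoreTrace]
  simp only [mem_filter, mem_univ, true_and]
  exact and_congr_right fun hj =>
    ⟨fun h' => (mem_scoreTrace.1 hk).2.trans h', fun h' => hmin j (mem_scoreTrace.2 ⟨hj, h'⟩)⟩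

/-- This converse makes the imbalance event equal to a finite union, not merely contained in one;
its null measurability relies on that. -/
theorem exists_scoreTrace_eq_upperPart {V : 𝒳 → 𝒴 → EReal} {H : Set (𝒳 → Bool)}
    {z : κ → 𝒳 × 𝒴} {A : Finset κ} (hA : A ∈ traces H (fun j => (z j).1)) (k : κ) :
    ∃ h ∈ H, ∃ η, scoreTrace V h η z = upperPart V z A k := by
  obtain ⟨h, hH, hh⟩ := mem_traces.1 hA
  refine ⟨h, hH, V (z k).1 (z k).2, ?_⟩
  ext j
  rw [mem_upperPart, mem_scoreTrace, hh]

end Trace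

/-! ### Union bound over swaps of a fixed double sample -/

section Double

variable {𝒳 𝒴 ι : Type*} [Fintype ι] [DecidableEq ι]

/-- The double samples on which some group and some threshold cut out an imbalanced set. -/
def imbalancedSamples (H : Set (𝒳 → Bool)) (V : 𝒳 → 𝒴 → EReal) (T : ℝ) :
    Set (ι ⊕ ι → 𝒳 × 𝒴) :=
  {z | ∃ h ∈ H, ∃ η, Imbalanced T (scoreTrace V h η z)}

theorem mem_imbalancedSamples {H : Set (𝒳 → Bool)} {V : 𝒳 → 𝒴 → EReal} {T : ℝ}
    {z : ι ⊕ ι → 𝒳 × 𝒴} :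
    z ∈ imbalancedSamples H V T ↔
      ∃ A ∈ traces H (fun j => (z j).1), ∃ k, Imbalanced T (upperPart V z A k) := by
  constructor
  · rintro ⟨h, hH, η, hI⟩
    have hne : (scoreTrace V h η z).Nonempty := by
      rw [nonempty_iff_ne_empty]
      intro h0
      exact not_imbalanced_empty T (h0 ▸ hI)
    obtain ⟨A, hA, k, hk⟩ := exists_upperPart_eq_scoreTrace hH hne
    exact ⟨A, hA, k, hk ▸ hI⟩
  · rintro ⟨A, hA, k, hI⟩
    obtain ⟨h, hH, η, hη⟩ := exists_scoreTrace_eq_upperPart (V := V) hA k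
    exact ⟨h, hH, η, hη ▸ hI⟩

-- Swapping permutes the indices of the points, so every set cut out after a swap is the preimage of
-- a set cut out of the original `z`. The union therefore runs over one family of pairs (A, k),
-- independent of σ.
open Classical in
theorem card_swaps_mem_imbalancedSamples_le {H : Set (𝒳 → Bool)} {R : ℕ} (hR : vcDim H ≤ R)
    (V : 𝒳 → 𝒴 → EReal) {T : ℝ} (hT : 0 ≤ T) (z : ι ⊕ ι → 𝒳 × 𝒴) :
    ((univ.filter fun σ : ι → Bool =>
      (fun j => z (swapPerm σ j)) ∈ imbalancedSamples H V T).card : ℝ) ≤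
      2 ^ Fintype.card ι * ((2 * Fintype.card ι + 1) ^ R * (2 * Fintype.card ι) *
        (2 * Real.exp (-(8 * T)))) := by
  set Q : Finset (Finset (ι ⊕ ι) × (ι ⊕ ι)) := traces H (fun j => (z j).1) ×ˢ univ
  have hsub : (univ.filter fun σ : ι → Bool =>
      (fun j => z (swapPerm σ j)) ∈ imbalancedSamples H V T) ⊆
      Q.biUnion fun q => univ.filter fun σ : ι → Bool =>
        Imbalanced T (univ.filter fun j => swapPerm σ j ∈ upperPart V z q.1 q.2) := by
    intro σ hσ
    obtain ⟨h, hH, η, hI⟩ := (mem_filter.1 hσ).2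
    have htr : scoreTrace V h η (fun j => z (swapPerm σ j)) =
        univ.filter fun j => swapPerm σ j ∈ scoreTrace V h η z := by
      ext j
      simp [mem_scoreTrace]
    rw [htr] at hI
    have hne : (scoreTrace V h η z).Nonempty := by
      rw [nonempty_iff_ne_empty]
      intro h0
      simp only [h0, notMem_empty, filter_false] at hI
      exact not_imbalanced_empty T hI
    obtain ⟨A, hA, k, hk⟩ := exists_upperPart_eq_scoreTrace hH hne
    refine mem_biUnion.2 ⟨(A, k), mem_product.2 ⟨hA, mem_univ _⟩, mem_filter.2 ⟨mem_univ _, ?_⟩⟩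
    simpa only [hk] using hI
  have h1 : ((univ.filter fun σ : ι → Bool =>
      (fun j => z (swapPerm σ j)) ∈ imbalancedSamples H V T).card : ℝ) ≤
      ∑ q ∈ Q, ((univ.filter fun σ : ι → Bool =>
        Imbalanced T (univ.filter fun j => swapPerm σ j ∈ upperPart V z q.1 q.2)).card : ℝ) := by
    exact_mod_cast (card_le_card hsub).trans card_biUnion_le
  have h2 := h1.trans (sum_le_card_nsmul Q _ _ fun q _ => card_imbalanced_le hT _)
  have h3 : (Q.card : ℝ) ≤ (2 * Fintype.card ι + 1) ^ R * (2 * Fintype.card ι) := by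
    have h := card_traces_le hR (fun j => (z j).1)
    rw [Fintype.card_sum, ← two_mul] at h
    rw [card_product, card_univ, Fintype.card_sum, ← two_mul]
    exact_mod_cast Nat.mul_le_mul_right _ h
  refine h2.trans ?_
  rw [nsmul_eq_mul]
  calc (Q.card : ℝ) * (2 ^ Fintype.card ι * (2 * Real.exp (-(8 * T))))
      ≤ ((2 * Fintype.card ι + 1) ^ R * (2 * Fintype.card ι)) *
        (2 ^ Fintype.card ι * (2 * Real.exp (-(8 * T)))) :=
        mul_le_mul_of_nonneg_right h3 (by positivity)
    _ = _ := by ring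

end Double

/-! ### Measurability and probability of an imbalance -/

section Measurability

variable {𝒳 𝒴 : Type*} [MeasurableSpace 𝒳] [MeasurableSpace 𝒴]

theorem measurePreserving_comp_equiv {κ κ' Z : Type*} [Fintype κ] [Fintype κ'] [MeasurableSpace Z]
    (P : Measure Z) [SigmaFinite P] (e : κ ≃ κ') :
    MeasurePreserving (fun (z : κ' → Z) (j : κ) => z (e j))
      (Measure.pi fun _ => P) (Measure.pi fun _ => P) := by
  have h := measurePreserving_piCongrLeft (fun _ : κ => P) e.symm
  have h2 : (MeasurableEquiv.piCongrLeft (fun _ : κ => Z) e.symm : (κ' → Z) → (κ → Z)) =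
      fun z j => z (e j) := by
    funext z j
    have := MeasurableEquiv.piCongrLeft_apply_apply (β := fun _ : κ => Z) e.symm z (e j)
    simpa using this
  rwa [h2] at h

theorem TraceMeasurable.nullMeasurableSet {κ : Type*} [Fintype κ] {H : Set (𝒳 → Bool)}
    {P : Measure (𝒳 × 𝒴)} [IsProbabilityMeasure P] (hH : TraceMeasurable H P.fst) (A : Finset κ) :
    NullMeasurableSet {z : κ → 𝒳 × 𝒴 | A ∈ traces H (fun j => (z j).1)}
      (Measure.pi fun _ => P) := by
  classical
  set e := Fintype.equivFin κ
  have h1 := hH _ fun i => decide (e.symm i ∈ A)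
  have h2 := measurePreserving_comp_equiv P.fst e.symm
  have h3 : MeasurePreserving (fun (z : κ → 𝒳 × 𝒴) (j : κ) => (z j).1)
      (Measure.pi fun _ => P) (Measure.pi fun _ => P.fst) :=
    measurePreserving_pi _ _ fun _ => ⟨measurable_fst, rfl⟩
  have h4 := h1.preimage (h2.comp h3).quasiMeasurePreserving
  convert h4 using 1
  ext z
  simp only [Set.mem_ofPred_eq, mem_traces, Set.mem_preimage, Function.comp_apply]
  refine exists_congr fun h => and_congr_right fun _ => ?_
  constructor
  · intro hh i
    rw [Bool.eq_iff_iff, hh, decide_eq_true_iff]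
  · intro hh j
    have := hh (e j)
    rw [Bool.eq_iff_iff, decide_eq_true_iff] at this
    simpa using this

/-- The upper part takes finitely many values, each on a set described by finitely many comparisons
of scores. -/
theorem measurableSet_imbalanced_upperPart {ι : Type*} [Fintype ι] [DecidableEq ι]
    {V : 𝒳 → 𝒴 → EReal} (hV : Measurable fun z : 𝒳 × 𝒴 => V z.1 z.2) (T : ℝ)
    (A : Finset (ι ⊕ ι)) (k : ι ⊕ ι) :
    MeasurableSet {z : ι ⊕ ι → 𝒳 × 𝒴 | Imbalanced T (upperPart V z A k)} := by
  have h1 : {z : ι ⊕ ι → 𝒳 × 𝒴 | Imbalanced T (upperPart V z A k)} =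
      ⋃ t ∈ {t : Finset (ι ⊕ ι) | Imbalanced T t}, ⋂ j,
        {z : ι ⊕ ι → 𝒳 × 𝒴 | (j ∈ A ∧ V (z k).1 (z k).2 ≤ V (z j).1 (z j).2) ↔ j ∈ t} := by
    ext z
    simp only [Set.mem_ofPred_eq, Set.mem_iUnion, Set.mem_iInter, ← mem_upperPart, exists_prop]
    constructor
    · exact fun h => ⟨_, h, fun _ => Iff.rfl⟩
    · rintro ⟨t, ht, h⟩
      rwa [Finset.ext h]
  rw [h1]
  refine MeasurableSet.biUnion (Set.to_countable _) fun t _ => MeasurableSet.iInter fun j => ?_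
  have hle : MeasurableSet {z : ι ⊕ ι → 𝒳 × 𝒴 | V (z k).1 (z k).2 ≤ V (z j).1 (z j).2} :=
    measurableSet_le (hV.comp (measurable_pi_apply k)) (hV.comp (measurable_pi_apply j))
  by_cases hj : j ∈ t <;> by_cases hA : j ∈ A <;> simp only [hj, hA, iff_true, iff_false, true_and,
    false_and, Set.ofPred_true, Set.ofPred_false, MeasurableSet.univ,
    MeasurableSet.empty]
  · exact hle
  · exact hle.compl

theorem nullMeasurableSet_imbalancedSamples {ι : Type*} [Fintype ι] [DecidableEq ι]
    {H : Set (𝒳 → Bool)} {P : Measure (𝒳 × 𝒴)} [IsProbabilityMeasure P]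
    (hH : TraceMeasurable H P.fst)
    {V : 𝒳 → 𝒴 → EReal} (hV : Measurable fun z : 𝒳 × 𝒴 => V z.1 z.2) (T : ℝ) :
    NullMeasurableSet (imbalancedSamples H V T : Set (ι ⊕ ι → 𝒳 × 𝒴))
      (Measure.pi fun _ => P) := by
  have h1 : (imbalancedSamples H V T : Set (ι ⊕ ι → 𝒳 × 𝒴)) =
      ⋃ A, ⋃ k, {z : ι ⊕ ι → 𝒳 × 𝒴 | A ∈ traces H (fun j => (z j).1)} ∩
        {z | Imbalanced T (upperPart V z A k)} := by
    ext z
    simp [mem_imbalancedSamples]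
  rw [h1]
  exact NullMeasurableSet.iUnion fun A => NullMeasurableSet.iUnion fun k =>
    (hH.nullMeasurableSet A).inter
      (measurableSet_imbalanced_upperPart hV T A k).nullMeasurableSet

/-- Every swap preserves the product law, so the probability equals its average over all swaps.
Exchanging sum and integral leaves, for each sample, the proportion of bad swaps, which is bounded
uniformly. -/
theorem measure_imbalancedSamples_le {ι : Type*} [Fintype ι] [DecidableEq ι]
    {H : Set (𝒳 → Bool)} {P : Measure (𝒳 × 𝒴)} [IsProbabilityMeasure P]
    (hH : TraceMeasurable H P.fst) {R : ℕ} (hR : vcDim H ≤ R)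
    {V : 𝒳 → 𝒴 → EReal} (hV : Measurable fun z : 𝒳 × 𝒴 => V z.1 z.2) {T : ℝ} (hT : 0 ≤ T) :
    Measure.pi (fun _ : ι ⊕ ι => P) (imbalancedSamples H V T) ≤
      ENNReal.ofReal ((2 * Fintype.card ι + 1) ^ R * (2 * Fintype.card ι) *
        (2 * Real.exp (-(8 * T)))) := by
  classical
  set ν := Measure.pi (fun _ : ι ⊕ ι => P)
  set B : Set (ι ⊕ ι → 𝒳 × 𝒴) := imbalancedSamples H V T
  set K : ℝ := (2 * Fintype.card ι + 1) ^ R * (2 * Fintype.card ι) * (2 * Real.exp (-(8 * T)))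
  have hB : NullMeasurableSet B ν := nullMeasurableSet_imbalancedSamples hH hV T
  have hmp : ∀ σ : ι → Bool, MeasurePreserving
      (fun (z : ι ⊕ ι → 𝒳 × 𝒴) j => z (swapPerm σ j)) ν ν :=
    fun σ => measurePreserving_comp_equiv P (swapPerm σ)
  have hBσ : ∀ σ : ι → Bool, NullMeasurableSet
      ((fun (z : ι ⊕ ι → 𝒳 × 𝒴) j => z (swapPerm σ j)) ⁻¹' B) ν :=
    fun σ => hB.preimage (hmp σ).quasiMeasurePreserving
  have h1 : (2 : ENNReal) ^ Fintype.card ι * ν B = ∑ σ : ι → Bool, ∫⁻ z,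
      ((fun (z : ι ⊕ ι → 𝒳 × 𝒴) j => z (swapPerm σ j)) ⁻¹' B).indicator (fun _ => 1) z ∂ν := by
    simp_rw [lintegral_indicator_const₀ (hBσ _), (hmp _).measure_preimage hB]
    simp
  have h2 : ∑ σ : ι → Bool, ∫⁻ z,
      ((fun (z : ι ⊕ ι → 𝒳 × 𝒴) j => z (swapPerm σ j)) ⁻¹' B).indicator (fun _ => 1) z ∂ν ≤
      ENNReal.ofReal (2 ^ Fintype.card ι * K) := by
    rw [← lintegral_finsetSum' _ fun σ _ => (aemeasurable_indicator_const_iff 1).2 (hBσ σ)]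
    refine (lintegral_mono (g := fun _ => ENNReal.ofReal (2 ^ Fintype.card ι * K))
      fun z => ?_).trans (by simp)
    have h := ENNReal.ofReal_le_ofReal (card_swaps_mem_imbalancedSamples_le hR V hT z)
    rw [ENNReal.ofReal_natCast] at h
    refine le_trans (le_of_eq ?_) h
    simp [Set.indicator_apply, B]
  rw [← h1, ENNReal.ofReal_mul (by positivity), ENNReal.ofReal_pow (by norm_num),
    ENNReal.ofReal_ofNat] at h2
  exact (ENNReal.mul_le_mul_iff_right (by simp) (by simp)).1 h2

end Measurability

/-! ### Chebyshev bound for the ghost count -/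

section Chebyshev

open Classical in
theorem half_le_measure_count_sq_sub_le {Z : Type*} [MeasurableSpace Z] (P : Measure Z)
    [IsProbabilityMeasure P] (N : ℕ) {S : Set Z} (hS : MeasurableSet S) :
    (1 / 2 : ENNReal) ≤ Measure.pi (fun _ : Fin N => P)
      {d | (((univ.filter fun i => d i ∈ S).card : ℝ) - N * P.real S) ^ 2 ≤
        2 * (N * P.real S) + 2} := by
  set ν := Measure.pi (fun _ : Fin N => P)
  set s := P.real S
  have hs : 0 ≤ s := measureReal_nonneg
  set X : (Fin N → Z) → ℝ := ∑ i, fun d => S.indicator (fun _ => (1 : ℝ)) (d i)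
  have hXc : ∀ d, X d = ((univ.filter fun i => d i ∈ S).card : ℝ) := by
    intro d
    simp [X, Finset.sum_apply, Set.indicator_apply]
  have hL : MemLp (S.indicator fun _ => (1 : ℝ)) 2 P :=
    memLp_indicator_const 2 hS 1 (Or.inr (measure_ne_top _ _))
  have hLi : ∀ i : Fin N, MemLp (fun d : Fin N → Z => S.indicator (fun _ => (1 : ℝ)) (d i)) 2 ν :=
    fun i => hL.comp_measurePreserving (measurePreserving_eval _ i)
  have hX : MemLp X 2 ν := memLp_finsetSum' _ fun i _ => hLi i
  have hE : ν[X] = N * s := by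
    have h1 : ∀ i : Fin N, ∫ d, S.indicator (fun _ => (1 : ℝ)) (d i) ∂ν = s := by
      intro i
      have hmp := measurePreserving_eval (fun _ : Fin N => P) i
      have h := integral_map (μ := ν) hmp.aemeasurable (f := S.indicator fun _ => (1 : ℝ))
        (by rw [hmp.map_eq]; exact hL.aestronglyMeasurable)
      rw [hmp.map_eq, integral_indicator_const _ hS, smul_eq_mul, mul_one] at h
      exact h.symm
    simp only [X, Finset.sum_apply]
    rw [integral_finsetSum _ fun i _ => (hLi i).integrable (by norm_num)]
    simp [h1]
  have hvar : Var[X; ν] ≤ N * s := by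
    rw [variance_sum_pi fun _ => hL]
    have h1 : Var[S.indicator fun _ => (1 : ℝ); P] ≤ s := by
      refine (variance_le_expectation_sq hL.aestronglyMeasurable).trans (le_of_eq ?_)
      have : (S.indicator fun _ => (1 : ℝ)) ^ 2 = S.indicator fun _ => (1 : ℝ) := by
        ext z; by_cases hz : z ∈ S <;> simp [hz]
      rw [this, integral_indicator_const _ hS]
      simp [s]
    simpa using mul_le_mul_of_nonneg_left h1 (Nat.cast_nonneg N)
  -- The count has variance at most N s, so the Chebyshev ratio is at most N s / (2 N s + 2) ≤ 1/2;
  -- the summand 2 keeps c positive when s = 0.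
  set c := Real.sqrt (2 * (N * s) + 2)
  have hc : 0 < c := Real.sqrt_pos.2 (by positivity)
  have hc2 : c ^ 2 = 2 * (N * s) + 2 := Real.sq_sqrt (by positivity)
  have hch := meas_ge_le_variance_div_sq hX hc
  have hle : ν {d | c ≤ |X d - ν[X]|} ≤ 1 / 2 := by
    refine hch.trans ?_
    rw [show (1 / 2 : ENNReal) = ENNReal.ofReal (1 / 2) by
      rw [ENNReal.ofReal_div_of_pos two_pos]; simp]
    refine ENNReal.ofReal_le_ofReal ?_
    rw [hc2, div_le_div_iff₀ (by positivity) two_pos]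
    linarith
  have hsub : {d | c ≤ |X d - ν[X]|}ᶜ ⊆ {d | (((univ.filter fun i => d i ∈ S).card : ℝ) -
      N * s) ^ 2 ≤ 2 * (N * s) + 2} := by
    intro d hd
    rw [Set.mem_compl_iff, Set.mem_ofPred_eq, not_le, hE, hXc] at hd
    rw [Set.mem_ofPred_eq, ← hc2, ← sq_abs]
    exact pow_le_pow_left₀ (abs_nonneg _) hd.le 2
  refine le_trans ?_ (measure_mono hsub)
  have h1 : (1 : ENNReal) ≤ ν {d | c ≤ |X d - ν[X]|} + ν {d | c ≤ |X d - ν[X]|}ᶜ := by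
    simpa using measure_univ_le_add_compl (μ := ν) {d | c ≤ |X d - ν[X]|}
  have h2 : (1 / 2 : ENNReal) + 1 / 2 ≤ 1 / 2 + ν {d | c ≤ |X d - ν[X]|}ᶜ := by
    rw [ENNReal.add_halves]
    exact h1.trans (add_le_add_left hle _)
  exact (ENNReal.add_le_add_iff_left (by simp)).1 h2

end Chebyshev

/-! ### Deterministic inequalities on counts and ratios -/

section Deterministic

theorem abs_sub_eq_abs_sqrt_sub_sqrt_mul {u v : ℝ} (hu : 0 ≤ u) (hv : 0 ≤ v) :
    |u - v| = |Real.sqrt u - Real.sqrt v| * (Real.sqrt u + Real.sqrt v) := by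
  rw [← abs_of_nonneg (a := Real.sqrt u + Real.sqrt v) (by positivity), ← abs_mul]
  congr 1
  linear_combination -Real.sq_sqrt hu + Real.sq_sqrt hv

/-- Factor u - v as a difference of squares of roots and cancel √u + √v, which dominates √(u + v).
Unlike the hypothesis, the conclusion can be chained by the triangle inequality. -/
theorem abs_sqrt_sub_sqrt_le_of_abs_sub_le {u v T : ℝ} (hu : 0 ≤ u) (hv : 0 ≤ v) (hT : 0 ≤ T)
    (h : |u - v| ≤ 4 * Real.sqrt (T * (u + v))) :
    |Real.sqrt u - Real.sqrt v| ≤ 4 * Real.sqrt T := by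
  have hx := Real.sqrt_nonneg u
  have hy := Real.sqrt_nonneg v
  have ht := Real.sqrt_nonneg T
  have hadd : Real.sqrt (u + v) ≤ Real.sqrt u + Real.sqrt v := by
    refine Real.sqrt_le_iff.2 ⟨add_nonneg hx hy, ?_⟩
    nlinarith [Real.sq_sqrt hu, Real.sq_sqrt hv, mul_nonneg hx hy]
  rw [Real.sqrt_mul hT] at h
  have hfac := abs_sub_eq_abs_sqrt_sub_sqrt_mul hu hv
  rcases (add_nonneg hx hy).eq_or_lt with h0 | h0
  · have h1 : Real.sqrt u = 0 := by linarith
    have h2 : Real.sqrt v = 0 := by linarith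
    rw [h1, h2]
    simp
  · refine le_of_mul_le_mul_right ?_ h0
    rw [← hfac]
    refine h.trans ?_
    have := mul_le_mul_of_nonneg_left hadd ht
    linarith

theorem abs_sqrt_sub_sqrt_le_of_sq_sub_le {v s T : ℝ} (hv : 0 ≤ v) (hs : 0 ≤ s) (hT : 1 / 2 ≤ T)
    (h : (v - s) ^ 2 ≤ 2 * s + 2) :
    |Real.sqrt v - Real.sqrt s| ≤ 4 * Real.sqrt T := by
  have hT0 : 0 ≤ T := by linarith
  -- If s ≥ T ≥ 1/2, then 2s + 2 ≤ 16 T (s + v) and the previous lemma applies. If s < T, then v ≤ s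
  -- + 4T, and both roots are at most 4√T.
  rcases le_or_gt T s with hTs | hTs
  · refine abs_sqrt_sub_sqrt_le_of_abs_sub_le hv hs hT0 ?_
    have h4 : (4 : ℝ) = Real.sqrt 16 := by
      rw [show (16 : ℝ) = 4 ^ 2 by norm_num, Real.sqrt_sq (by norm_num)]
    rw [h4, ← Real.sqrt_mul (by norm_num)]
    refine Real.abs_le_sqrt (h.trans ?_)
    nlinarith [mul_nonneg hT0 hv]
  · have hs' : Real.sqrt s ≤ 4 * Real.sqrt T := by
      linarith [Real.sqrt_le_sqrt hTs.le, Real.sqrt_nonneg T]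
    have hv' : Real.sqrt v ≤ 4 * Real.sqrt T := by
      refine Real.sqrt_le_iff.2 ⟨by positivity, ?_⟩
      rw [mul_pow, Real.sq_sqrt hT0]
      have h1 : (v - s) ^ 2 ≤ (4 * T) ^ 2 := by nlinarith
      linarith [abs_le_of_sq_le_sq h1 (by positivity), le_abs_self (v - s)]
    rw [abs_le]
    constructor <;> linarith [Real.sqrt_nonneg s, Real.sqrt_nonneg v]

theorem abs_sub_le_of_abs_sqrt_sub_sqrt_le {u s T : ℝ} (hu : 0 ≤ u) (hs : 0 ≤ s) (hT : 0 ≤ T)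
    (h : |Real.sqrt u - Real.sqrt s| ≤ 8 * Real.sqrt T) :
    |u - s| ≤ 16 * Real.sqrt (T * u) + 64 * T := by
  have hx := Real.sqrt_nonneg u
  have hy := Real.sqrt_nonneg s
  have ht := Real.sqrt_nonneg T
  have hfac := abs_sub_eq_abs_sqrt_sub_sqrt_mul hu hs
  have h1 : Real.sqrt u + Real.sqrt s ≤ 2 * Real.sqrt u + 8 * Real.sqrt T := by
    linarith [(abs_le.1 h).1]
  rw [hfac, Real.sqrt_mul hT]
  calc |Real.sqrt u - Real.sqrt s| * (Real.sqrt u + Real.sqrt s)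
      ≤ (8 * Real.sqrt T) * (2 * Real.sqrt u + 8 * Real.sqrt T) :=
        mul_le_mul h h1 (add_nonneg hx hy) (by positivity)
    _ = 16 * (Real.sqrt T * Real.sqrt u) + 64 * T := by
        nlinarith [Real.sq_sqrt hT]

/-- Transfer from the ghost sample to the population: `u` and `v` are the counts of a set in the
two samples and `s` its expected count. -/
theorem abs_count_sub_le {u v s T : ℝ} (hu : 0 ≤ u) (hv : 0 ≤ v) (hs : 0 ≤ s) (hT : 1 / 2 ≤ T)
    (huv : |u - v| ≤ 4 * Real.sqrt (T * (u + v))) (hvs : (v - s) ^ 2 ≤ 2 * s + 2) :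
    |u - s| ≤ 16 * Real.sqrt (T * u) + 64 * T := by
  have hT0 : 0 ≤ T := by linarith
  refine abs_sub_le_of_abs_sqrt_sub_sqrt_le hu hs hT0 ?_
  have h1 := abs_sqrt_sub_sqrt_le_of_abs_sub_le hu hv hT0 huv
  have h2 := abs_sqrt_sub_sqrt_le_of_sq_sub_le hv hs hT hvs
  linarith [abs_sub_le (Real.sqrt u) (Real.sqrt v) (Real.sqrt s)]

/-- A bound for the difference of two ratios in `[0, 1]` in terms of the deviations of numerators
and denominators. -/
theorem abs_div_sub_div_le {a d q p T : ℝ} (ha : 0 ≤ a) (had : a ≤ d) (hd : 0 < d)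
    (hq : 0 ≤ q) (hqp : q ≤ p) (hT : 0 ≤ T)
    (h1 : |a - q| ≤ 16 * Real.sqrt (T * a) + 64 * T)
    (h2 : |d - p| ≤ 16 * Real.sqrt (T * d) + 64 * T) :
    |a / d - q / p| ≤ 160 * Real.sqrt (T / d) := by
  have hx : 0 ≤ a / d := by positivity
  have hx1 : a / d ≤ 1 := (div_le_one hd).2 had
  have hp : 0 ≤ p := hq.trans hqp
  have hy : 0 ≤ q / p := by positivity
  have hy1 : q / p ≤ 1 := div_le_one_of_le₀ hqp hp
  -- For T ≤ d, the term 64T is absorbed into 64√(Td), so numerator and denominator each contribute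
  -- 16 + 64 = 80. For T > d the right side exceeds 1 and the bound is trivial.
  rcases le_or_gt T d with hTd | hTd
  · have hqp' : q / p * p = q := by
      rcases hp.eq_or_lt with h0 | h0
      · rw [← h0] at hqp ⊢
        simp [le_antisymm hqp hq]
      · field_simp
    have h3 : (a / d - q / p) * d = (a - q) + q / p * (p - d) := by
      rw [sub_mul, div_mul_cancel₀ _ hd.ne', mul_sub, hqp']
      ring
    have h4 : |a / d - q / p| * d ≤ |a - q| + |d - p| := by
      rw [← abs_of_pos hd, ← abs_mul, abs_of_pos hd, h3]
      refine (abs_add_le _ _).trans (add_le_add_right ?_ _)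
      rw [abs_mul, abs_of_nonneg hy, abs_sub_comm p d]
      exact mul_le_of_le_one_left (abs_nonneg _) hy1
    have h5 : Real.sqrt (T * a) ≤ Real.sqrt (T * d) :=
      Real.sqrt_le_sqrt (mul_le_mul_of_nonneg_left had hT)
    have h6 : T ≤ Real.sqrt (T * d) := Real.le_sqrt_of_sq_le (by nlinarith)
    have h7 : Real.sqrt (T * d) = Real.sqrt (T / d) * d := by
      rw [show T * d = T / d * d ^ 2 by field_simp, Real.sqrt_mul (by positivity),
        Real.sqrt_sq hd.le]
    refine le_of_mul_le_mul_right ?_ hd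
    rw [mul_assoc, ← h7]
    linarith
  · have h3 : 1 ≤ Real.sqrt (T / d) := by
      rw [Real.one_le_sqrt, le_div_iff₀ hd]
      linarith
    have h4 : |a / d - q / p| ≤ 1 := by
      rw [abs_le]
      constructor <;> linarith
    linarith

/-- The cardinality factors are at most N^(3R + 4) ≤ N^(8R), the last step by R ≥ 1, and the factor
exp(-8 R log N) cancels this power. The leading 2 is the cost of symmetrization. -/
theorem union_bound_le {N R : ℕ} (hN : 2 ≤ N) (hR : 1 ≤ R) (τ : ℝ) :
    2 * ((2 * N + 1) ^ R * (2 * N) * (2 * Real.exp (-(8 * (R * Real.log N + τ))))) ≤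
      Real.exp (-(8 * τ)) := by
  have hN' : (2 : ℝ) ≤ N := by exact_mod_cast hN
  have hN0 : (0 : ℝ) < N := by linarith
  have h1 : (2 * N + 1 : ℝ) ≤ N ^ 3 := by nlinarith [sq_nonneg ((N : ℝ) - 2)]
  have h2 : (8 * N : ℝ) ≤ N ^ 4 := by
    have : (8 : ℝ) ≤ N ^ 3 := by nlinarith [sq_nonneg ((N : ℝ) - 2)]
    nlinarith
  have h3 : (2 * N + 1 : ℝ) ^ R * (8 * N) ≤ N ^ (8 * R) := by
    calc (2 * N + 1 : ℝ) ^ R * (8 * N) ≤ (N ^ 3) ^ R * N ^ 4 := by gcongr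
      _ = N ^ (3 * R + 4) := by rw [← pow_mul, ← pow_add]
      _ ≤ N ^ (8 * R) := pow_le_pow_right₀ (by linarith) (by omega)
  have h4 : Real.exp (-(8 * (R * Real.log N + τ))) =
      ((N : ℝ) ^ (8 * R))⁻¹ * Real.exp (-(8 * τ)) := by
    rw [← Real.exp_log (pow_pos hN0 (8 * R)), ← Real.exp_neg, ← Real.exp_add, Real.log_pow]
    push_cast
    congr 1
    ring
  rw [h4]
  have h5 : (2 * N + 1 : ℝ) ^ R * (8 * N) * ((N : ℝ) ^ (8 * R))⁻¹ ≤ 1 := by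
    rw [← div_eq_mul_inv]
    exact div_le_one_of_le₀ h3 (by positivity)
  calc _ = (2 * N + 1 : ℝ) ^ R * (8 * N) * ((N : ℝ) ^ (8 * R))⁻¹ * Real.exp (-(8 * τ)) := by ring
    _ ≤ 1 * Real.exp (-(8 * τ)) := mul_le_mul_of_nonneg_right h5 (Real.exp_pos _).le
    _ = _ := one_mul _

theorem half_le_mul_log_add {N R : ℕ} (hN : 2 ≤ N) (hR : 1 ≤ R) {τ : ℝ} (hτ : 0 < τ) :
    1 / 2 ≤ R * Real.log N + τ := by
  have h1 : Real.log 2 ≤ Real.log N := Real.log_le_log two_pos (by exact_mod_cast hN)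
  have h2 : (1 : ℝ) ≤ R := by exact_mod_cast hR
  nlinarith [Real.log_two_gt_d9]

end Deterministic

/-! ### Coverage and imbalance in terms of counts -/

section Counts

variable {𝒳 𝒴 : Type*}

theorem card_scoreTrace_sumElim {N : ℕ} (V : 𝒳 → 𝒴 → EReal) (h : 𝒳 → Bool) (η : EReal)
    (d d' : Fin N → 𝒳 × 𝒴) :
    ((scoreTrace V h η (Sum.elim d d')).card : ℝ) =
      (scoreTrace V h η d).card + (scoreTrace V h η d').card := by
  classical
  rw [card_sum_eq, sum_add_distrib]
  simp [scoreTrace]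

theorem imbalance_scoreTrace_sumElim {N : ℕ} (V : 𝒳 → 𝒴 → EReal) (h : 𝒳 → Bool) (η : EReal)
    (d d' : Fin N → 𝒳 × 𝒴) :
    imbalance (scoreTrace V h η (Sum.elim d d')) =
      (scoreTrace V h η d).card - (scoreTrace V h η d').card := by
  classical
  rw [imbalance, sum_sub_distrib]
  simp [scoreTrace]

theorem selectedGroup_eq_scoreTrace {N : ℕ} (V : 𝒳 → 𝒴 → EReal) (h : 𝒳 → Bool)
    (d : Fin N → 𝒳 × 𝒴) : selectedGroup h d = scoreTrace V h ⊥ d := by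
  ext i
  simp [selectedGroup, mem_scoreTrace]

theorem empiricalCoverage_eq {N : ℕ} (V : 𝒳 → 𝒴 → EReal) (η : EReal) (h : 𝒳 → Bool)
    (d : Fin N → 𝒳 × 𝒴) :
    empiricalCoverage (predictionSet V η) h d =
      ((scoreTrace V h η d).card : ℝ) / (scoreTrace V h ⊥ d).card := by
  classical
  rw [empiricalCoverage, selectedGroup_eq_scoreTrace V]
  congr 3
  ext i
  rw [mem_filter, mem_scoreTrace, mem_scoreTrace]
  simp [predictionSet]

end Counts

/-! ### From the ghost sample to the population -/

section Ghost

variable {𝒳 𝒴 : Type*} [MeasurableSpace 𝒳] [MeasurableSpace 𝒴]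

/-- The observations in the group of `h` with score at least `η`. -/
def scoreSet (V : 𝒳 → 𝒴 → EReal) (h : 𝒳 → Bool) (η : EReal) : Set (𝒳 × 𝒴) :=
  {z | h z.1 = true ∧ η ≤ V z.1 z.2}

theorem measurableSet_scoreSet {V : 𝒳 → 𝒴 → EReal} (hV : Measurable fun z : 𝒳 × 𝒴 => V z.1 z.2)
    {h : 𝒳 → Bool} (hh : Measurable h) (η : EReal) : MeasurableSet (scoreSet V h η) :=
  MeasurableSet.inter ((hh.comp measurable_fst) (measurableSet_singleton true))
    (measurableSet_le measurable_const hV)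

/-- If no imbalance is likely to appear after adjoining an independent copy to the sample `d`, then
all counts in `d` are close to their expectations. -/
theorem abs_card_scoreTrace_sub_le {P : Measure (𝒳 × 𝒴)} [IsProbabilityMeasure P] {N : ℕ}
    {V : 𝒳 → 𝒴 → EReal} (hV : Measurable fun z : 𝒳 × 𝒴 => V z.1 z.2) {H : Set (𝒳 → Bool)}
    {T : ℝ} (hT : 1 / 2 ≤ T) {d : Fin N → 𝒳 × 𝒴}
    (hd : Measure.pi (fun _ : Fin N => P) {d' | Sum.elim d d' ∈ imbalancedSamples H V T} < 1 / 2)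
    {h : 𝒳 → Bool} (hH : h ∈ H) (hh : Measurable h) (η : EReal) :
    |((scoreTrace V h η d).card : ℝ) - N * P.real (scoreSet V h η)| ≤
      16 * Real.sqrt (T * (scoreTrace V h η d).card) + 64 * T := by
  classical
  have h1 := half_le_measure_count_sq_sub_le P N (measurableSet_scoreSet hV hh η)
  -- The Chebyshev event has probability at least 1/2 and the imbalance event strictly less, so some
  -- ghost sample lies in the first and not in the second. It may depend on `h` and η, whereas the
  -- condition on `d` does not; this gives uniformity.
  obtain ⟨d', hd1, hd2⟩ : ∃ d', d' ∈ {d' : Fin N → 𝒳 × 𝒴 |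
      (((univ.filter fun i => d' i ∈ scoreSet V h η).card : ℝ) - N * P.real (scoreSet V h η)) ^ 2 ≤
        2 * (N * P.real (scoreSet V h η)) + 2} ∧
      d' ∉ {d' | Sum.elim d d' ∈ imbalancedSamples H V T} := by
    by_contra hcon
    push Not at hcon
    exact absurd (h1.trans (measure_mono hcon)) (not_le.2 hd)
  have hcount : (univ.filter fun i => d' i ∈ scoreSet V h η) = scoreTrace V h η d' := by
    ext i
    rw [mem_filter, mem_scoreTrace]
    exact and_iff_right (mem_univ i)
  rw [Set.mem_ofPred_eq, hcount] at hd1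
  have hd3 : ¬ Imbalanced T (scoreTrace V h η (Sum.elim d d')) := fun hI => hd2 ⟨h, hH, η, hI⟩
  rw [Imbalanced, not_lt, card_scoreTrace_sumElim, imbalance_scoreTrace_sumElim] at hd3
  exact abs_count_sub_le (Nat.cast_nonneg _) (Nat.cast_nonneg _) (by positivity) hT hd3 hd1

/-- Symmetrization: outside a small measurable set of samples, an independent copy is unlikely to
produce an imbalance. -/
theorem exists_measurableSet_ghost (P : Measure (𝒳 × 𝒴)) [IsProbabilityMeasure P] {N : ℕ}
    (B : Set (Fin N ⊕ Fin N → 𝒳 × 𝒴)) :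
    ∃ G : Set (Fin N → 𝒳 × 𝒴), MeasurableSet G ∧
      Measure.pi (fun _ : Fin N => P) Gᶜ ≤ 2 * Measure.pi (fun _ : Fin N ⊕ Fin N => P) B ∧
      ∀ d ∈ G, Measure.pi (fun _ : Fin N => P) {d' | Sum.elim d d' ∈ B} < 1 / 2 := by
  set ν := Measure.pi (fun _ : Fin N => P)
  set ν₂ := Measure.pi (fun _ : Fin N ⊕ Fin N => P)
  have hmp : MeasurePreserving
      (fun q : (Fin N → 𝒳 × 𝒴) × (Fin N → 𝒳 × 𝒴) => Sum.elim q.1 q.2) (ν.prod ν) ν₂ := by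
    convert measurePreserving_sumPiEquivProdPi_symm (fun _ : Fin N ⊕ Fin N => P) using 1
    funext q j
    rcases j with j | j <;> rfl
  -- A measurable hull of `B` has the same measure, so Fubini applies to an arbitrary `B`.
  set M := (fun q : (Fin N → 𝒳 × 𝒴) × (Fin N → 𝒳 × 𝒴) => Sum.elim q.1 q.2) ⁻¹' toMeasurable ν₂ B
  have hM : MeasurableSet M := hmp.measurable (measurableSet_toMeasurable _ _)
  have hMν : ν.prod ν M = ν₂ B := by
    rw [hmp.measure_preimage (measurableSet_toMeasurable _ _).nullMeasurableSet,
      measure_toMeasurable]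
  have hmeas := measurable_measure_prodMk_left (ν := ν) hM
  -- Markov's inequality at level 1/2 for the section measures yields the factor 2.
  refine ⟨{d | ν (Prod.mk d ⁻¹' M) < 1 / 2}, measurableSet_lt hmeas measurable_const, ?_, ?_⟩
  · have hc : {d | ν (Prod.mk d ⁻¹' M) < 1 / 2}ᶜ = {d | 1 / 2 ≤ ν (Prod.mk d ⁻¹' M)} := by
      ext d
      simp
    have h1 := mul_meas_ge_le_lintegral (μ := ν) hmeas (1 / 2)
    rw [← Measure.prod_apply hM, hMν] at h1
    rw [hc]
    calc ν {d | 1 / 2 ≤ ν (Prod.mk d ⁻¹' M)}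
        = 2 * (1 / 2 * ν {d | 1 / 2 ≤ ν (Prod.mk d ⁻¹' M)}) := by
          rw [← mul_assoc, ENNReal.mul_div_cancel (by simp) (by simp), one_mul]
      _ ≤ 2 * ν₂ B := by gcongr
  · exact fun d hd => (measure_mono (t := Prod.mk d ⁻¹' M) fun d' hd' =>
      subset_toMeasurable ν₂ B hd').trans_lt hd

end Ghost

/-! ### Deviation of the conditional coverage -/

section Coverage

variable {𝒳 𝒴 : Type*} [MeasurableSpace 𝒳] [MeasurableSpace 𝒴]

/-- For a null group both sides are 0, by the conventions for conditioning and for division by zero.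
-/
theorem oracleCoverage_eq {P : Measure (𝒳 × 𝒴)} (V : 𝒳 → 𝒴 → EReal) (η : EReal) {h : 𝒳 → Bool}
    (hh : Measurable h) :
    oracleCoverage P (predictionSet V η) h =
      P.real (scoreSet V h η) / P.real (scoreSet V h ⊥) := by
  have hms : MeasurableSet {z : 𝒳 × 𝒴 | h z.1 = true} :=
    (hh.comp measurable_fst) (measurableSet_singleton true)
  have h1 : scoreSet V h ⊥ = {z : 𝒳 × 𝒴 | h z.1 = true} := by
    ext z
    simp [scoreSet]
  have h2 : scoreSet V h η = {z : 𝒳 × 𝒴 | h z.1 = true} ∩ {z | z.2 ∈ predictionSet V η z.1} := rfl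
  rw [oracleCoverage, measureReal_def, cond_apply hms, ENNReal.toReal_mul, ENNReal.toReal_inv, h1,
    h2, measureReal_def, measureReal_def, div_eq_inv_mul]

theorem abs_empiricalCoverage_sub_oracleCoverage_le {P : Measure (𝒳 × 𝒴)} [IsProbabilityMeasure P]
    {N : ℕ} (hN : 0 < N) {V : 𝒳 → 𝒴 → EReal} {h : 𝒳 → Bool} (hh : Measurable h)
    {d : Fin N → 𝒳 × 𝒴} {T : ℝ} (hT : 0 ≤ T)
    (hdev : ∀ η, |((scoreTrace V h η d).card : ℝ) - N * P.real (scoreSet V h η)| ≤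
      16 * Real.sqrt (T * (scoreTrace V h η d).card) + 64 * T) (η : EReal)
    (hpos : 0 < proportion h d) :
    |empiricalCoverage (predictionSet V η) h d - oracleCoverage P (predictionSet V η) h| ≤
      160 * Real.sqrt (T / (proportion h d * N)) := by
  have hN0 : (0 : ℝ) < N := by exact_mod_cast hN
  have hprop : proportion h d * N = (scoreTrace V h ⊥ d).card := by
    rw [proportion, selectedGroup_eq_scoreTrace V, div_mul_cancel₀ _ hN0.ne']
  have hd : (0 : ℝ) < (scoreTrace V h ⊥ d).card := hprop ▸ mul_pos hpos hN0
  rw [hprop, empiricalCoverage_eq, oracleCoverage_eq V η hh,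
    ← mul_div_mul_left (P.real (scoreSet V h η)) (P.real (scoreSet V h ⊥)) hN0.ne']
  refine abs_div_sub_div_le (Nat.cast_nonneg _) ?_ hd (by positivity) ?_ hT (hdev η) (hdev ⊥)
  · exact_mod_cast card_le_card fun i hi =>
      mem_scoreTrace.2 ⟨(mem_scoreTrace.1 hi).1, bot_le⟩
  · refine mul_le_mul_of_nonneg_left (measureReal_mono fun z hz => ?_) hN0.le
    exact ⟨hz.1, bot_le⟩

end Coverage

end GroupCoverage

/-! ### The uniform coverage bound -/

theorem proposition1 :
    ∃ C₁ : ℝ, 0 < C₁ ∧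
      ∀ (𝒳 𝒴 Ω : Type*) [MeasurableSpace 𝒳] [MeasurableSpace 𝒴] [MeasurableSpace Ω]
        (μ : Measure Ω) [IsProbabilityMeasure μ]
        (P : Measure (𝒳 × 𝒴)) [IsProbabilityMeasure P]
        (N : ℕ) (_ : 2 ≤ N)
        (D : Fin N → Ω → 𝒳 × 𝒴) (_ : ∀ i, HasLaw (D i) P μ) (_ : iIndepFun D μ)
        (V : 𝒳 → 𝒴 → EReal) (_ : Measurable fun z : 𝒳 × 𝒴 => V z.1 z.2)
        (H : Set (𝒳 → Bool)) (_ : ∀ h ∈ H, Measurable h)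
        (_ : GroupCoverage.TraceMeasurable H P.fst)
        (R : ℕ) (_ : 1 ≤ R) (_ : GroupCoverage.vcDim H ≤ R)
        (τ : ℝ) (_ : 0 < τ),
        ∃ E : Set Ω, MeasurableSet E ∧ 1 - Real.exp (-τ) ≤ μ.real E ∧
          ∀ ω ∈ E, ∀ h ∈ H, ∀ η : EReal,
            0 < GroupCoverage.proportion h (fun i => D i ω) →
            |GroupCoverage.empiricalCoverage (GroupCoverage.predictionSet V η) h (fun i => D i ω)
                - GroupCoverage.oracleCoverage P (GroupCoverage.predictionSet V η) h|
              ≤ C₁ * Real.sqrt ((R * Real.log N + τ) /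
                  (GroupCoverage.proportion h (fun i => D i ω) * N)) := by
  refine ⟨160, by norm_num, ?_⟩
  intro 𝒳 𝒴 Ω _ _ _ μ _ P _ N hN D hD hind V hV H hHm hH R hR hvc τ hτ
  set T : ℝ := R * Real.log N + τ
  have hT : 1 / 2 ≤ T := GroupCoverage.half_le_mul_log_add hN hR hτ
  have hT0 : 0 ≤ T := by linarith
  obtain ⟨G, hGm, hGν, hG⟩ := GroupCoverage.exists_measurableSet_ghost P
    (GroupCoverage.imbalancedSamples H V T : Set (Fin N ⊕ Fin N → 𝒳 × 𝒴))
  have hGc : Measure.pi (fun _ : Fin N => P) Gᶜ ≤ ENNReal.ofReal (Real.exp (-τ)) := by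
    refine hGν.trans ?_
    have h1 := GroupCoverage.measure_imbalancedSamples_le (ι := Fin N) hH hvc hV hT0
    rw [Fintype.card_fin] at h1
    calc 2 * Measure.pi (fun _ : Fin N ⊕ Fin N => P) (GroupCoverage.imbalancedSamples H V T)
        ≤ ENNReal.ofReal 2 * ENNReal.ofReal ((2 * N + 1) ^ R * (2 * N) *
            (2 * Real.exp (-(8 * T)))) := by
          rw [ENNReal.ofReal_ofNat]
          gcongr
      _ ≤ ENNReal.ofReal (Real.exp (-τ)) := by
          rw [← ENNReal.ofReal_mul zero_le_two]
          refine ENNReal.ofReal_le_ofReal ((GroupCoverage.union_bound_le hN hR τ).trans ?_)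
          exact Real.exp_le_exp.2 (by linarith)
  have hDm : AEMeasurable (fun ω i => D i ω) μ :=
    aemeasurable_pi_lambda _ fun i => (hD i).aemeasurable
  have hlaw : μ.map (fun ω i => D i ω) = Measure.pi fun _ : Fin N => P := by
    rw [(iIndepFun_iff_map_fun_eq_pi_map fun i => (hD i).aemeasurable).1 hind]
    congr 1
    funext i
    exact (hD i).map_eq
  -- The observations are only almost everywhere measurable, so the preimage of `G` is merely null
  -- measurable; it is replaced by a measurable subset of the same measure.
  obtain ⟨E, hEsub, hEm, hEae⟩ :=
    (hDm.nullMeasurableSet_preimage hGm).exists_measurable_subset_ae_eq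
  refine ⟨E, hEm, ?_, fun ω hω h hh η hpos => ?_⟩
  · have h1 : μ.real E = (Measure.pi fun _ : Fin N => P).real G := by
      rw [measureReal_def, measureReal_def, measure_congr hEae, ← hlaw,
        Measure.map_apply_of_aemeasurable hDm hGm]
    have h2 : (Measure.pi fun _ : Fin N => P).real Gᶜ ≤ Real.exp (-τ) :=
      ENNReal.toReal_le_of_le_ofReal (Real.exp_pos _).le hGc
    rw [probReal_compl_eq_one_sub hGm] at h2
    linarith
  · exact GroupCoverage.abs_empiricalCoverage_sub_oracleCoverage_le (by omega) (hHm h hh) hT0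
      (fun η => GroupCoverage.abs_card_scoreTrace_sub_le hV hT (hG _ (hEsub hω)) hh (hHm h hh) η)
      η hpos
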